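/- Let $\mathbb F$ be a subfield of $\overline{\mathbb Q}$, let $n\ge 1$, and let $\sigma$ be the $\mathbb F$-automorphism of the rational function field $\mathbb F(\alpha_1,\dots,\alpha_n)$ with $\sigma(\alpha_i)=\lambda_i\alpha_i$ for $1\le i\le n$, where $\lambda_1,\dots,\lambda_n\in\mathbb F\setminus\{0\}$. Let $c\in\mathbb F\setminus\{0\}$. For $p,q\in\mathbb F[\alpha_1,\dots,\alpha_n]$ put $$\operatorname{Spr}_\sigma(p,q)=\{k\in\mathbb Z : \sigma^k(p)=u\,q\text{ for some }u\in\mathbb F\setminus\{0\}\},$$ and write $p\nsim_\sigma q$ if $\operatorname{Spr}_\sigma(p,q)=\emptyset$. A rational function $f\in\mathbb F(\alpha_1,\dots,\alpha_n)$ is called $c\sigma$-summable in $\mathbb F(\alpha_1,\dots,\alpha_n)$ if $f=c\,\sigma(g)-g$ for some $g\in\mathbb F(\alpha_1,\dots,\alpha_n)$. Let $f=a/d^j$, where $j\ge 1$ is an integer, $d\in\mathbb F[\alpha_1,\dots,\alpha_n]$ is irreducible with $d\nsim_\sigma\alpha_n$, and $a\in\mathbb F(\alpha_1,\dots,\alpha_{n-1})[\alpha_n]$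 with $\deg_{\alpha_n}(a)<\deg_{\alpha_n}(d)$ (where $\deg_{\alpha_n}(0)=-\infty$). If $\operatorname{Spr}_\sigma(d,d)=\{0\}$, then $f$ is $c\sigma$-summable in $\mathbb F(\alpha_1,\dots,\alpha_n)$ if and only if $a=0$. -/

import Mathlib

namespace MultivariateDifferenceField

open MvPolynomial

/-- The field `F(α₁, …, αₙ)` of rational functions in `n` variables over `F`. -/
abbrev RatField (n : ℕ) (F : Type*) [Field F] : Type _ :=
  FractionRing (MvPolynomial (Fin n) F)

/-- The `F`-automorphism `αᵢ ↦ lam i * αᵢ` of the polynomial ring `F[α₁, …, αₙ]`. -/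
noncomputable def sigmaPoly {n : ℕ} {F : Type*} [Field F] (lam : Fin n → Fˣ) :
    MvPolynomial (Fin n) F ≃ₐ[F] MvPolynomial (Fin n) F :=
  AlgEquiv.ofAlgHom
    (aeval fun i => C (lam i : F) * X i)
    (aeval fun i => C (((lam i)⁻¹ : Fˣ) : F) * X i)
    (by
      ext1 i
      simp [← mul_assoc, ← C_mul])
    (by
      ext1 i
      simp [← mul_assoc, ← C_mul])

/-- The `F`-automorphism `σ` of `F(α₁, …, αₙ)` with `σ(αᵢ) = lam i * αᵢ`: the extension of
`sigmaPoly lam` to the field of fractions. -/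
noncomputable def sigma {n : ℕ} {F : Type*} [Field F] (lam : Fin n → Fˣ) :
    RatField n F ≃ₐ[F] RatField n F :=
  IsFractionRing.fieldEquivOfAlgEquiv F (RatField n F) (RatField n F) (sigmaPoly lam)

theorem sigmaPoly_X {n : ℕ} {F : Type*} [Field F] (lam : Fin n → Fˣ) (i : Fin n) :
    sigmaPoly lam (X i) = C (lam i : F) * X i := by
  simp [sigmaPoly]

theorem sigma_algebraMap {n : ℕ} {F : Type*} [Field F] (lam : Fin n → Fˣ)
    (p : MvPolynomial (Fin n) F) :
    sigma lam (algebraMap (MvPolynomial (Fin n) F) (RatField n F) p) =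
      algebraMap (MvPolynomial (Fin n) F) (RatField n F) (sigmaPoly lam p) := by
  simp [sigma]

/-- The spread set `Spr_σ(p, q)` of integers `k` such that `σ^k(p) = c q` for some nonzero
constant `c ∈ F`. -/
def spread {n : ℕ} {F : Type*} [Field F] (lam : Fin n → Fˣ)
    (p q : MvPolynomial (Fin n) F) : Set ℤ :=
  {k : ℤ | ∃ c : F, c ≠ 0 ∧ (sigmaPoly lam ^ k) p = C c * q}

/-- `p ∼_σ q`: the spread set of `p` and `q` is nonempty. -/
def SigmaEquivalent {n : ℕ} {F : Type*} [Field F] (lam : Fin n → Fˣ)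
    (p q : MvPolynomial (Fin n) F) : Prop :=
  (spread lam p q).Nonempty

/-- `f` is `cσ`-summable in `F(α₁, …, αₙ)`: `f = c σ(g) - g` for some `g ∈ F(α₁, …, αₙ)`. -/
def IsSummable {n : ℕ} {F : Type*} [Field F] (lam : Fin n → Fˣ) (c : F)
    (f : RatField n F) : Prop :=
  ∃ g : RatField n F, f = algebraMap F (RatField n F) c * sigma lam g - g

theorem rename_castSucc_injective (m : ℕ) (F : Type*) [Field F] :
    Function.Injective
      (rename Fin.castSucc : MvPolynomial (Fin m) F →ₐ[F] MvPolynomial (Fin (m + 1)) F) :=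
  rename_injective _ (Fin.castSucc_injective m)

/-- The inclusion of `F(α₁, …, αₘ)` in `F(α₁, …, αₘ₊₁)` sending each variable `αᵢ` to `αᵢ`. -/
noncomputable def inclField (m : ℕ) (F : Type*) [Field F] :
    RatField m F →+* RatField (m + 1) F :=
  IsFractionRing.map (A := MvPolynomial (Fin m) F) (B := MvPolynomial (Fin (m + 1)) F)
    (rename_castSucc_injective m F)

theorem inclField_algebraMap (m : ℕ) (F : Type*) [Field F] (p : MvPolynomial (Fin m) F) :
    inclField m F (algebraMap (MvPolynomial (Fin m) F) (RatField m F) p) =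
      algebraMap (MvPolynomial (Fin (m + 1)) F) (RatField (m + 1) F)
        (rename Fin.castSucc p) := by
  simp [inclField, IsFractionRing.map]

/-- The inclusion of `F(α₁, …, αₘ)[αₘ₊₁]` in `F(α₁, …, αₘ₊₁)`: the polynomial variable is
sent to the last variable. -/
noncomputable def inclPoly (m : ℕ) (F : Type*) [Field F] :
    Polynomial (RatField m F) →+* RatField (m + 1) F :=
  Polynomial.eval₂RingHom (inclField m F)
    (algebraMap (MvPolynomial (Fin (m + 1)) F) (RatField (m + 1) F) (X (Fin.last m)))

end MultivariateDifferenceField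

namespace MultivariateDifferenceField

open MvPolynomial

/-! ### Orbits of an irreducible element and the poles of a twisted difference. -/

section Dispersion

variable {K R : Type*} [CommRing K] [CommRing R] [Algebra K R]

/-! A twisted difference `c σ(g) - g` cannot have poles at just one point of an infinite `σ`-orbit.
Let `g = p / q` be reduced and suppose some `σ^k d` divides `q`. Since the spread of `d` is trivial,
only finitely many `k` occur. The largest, `M`, gives an uncancelled pole at `σ^(M+1) d`, the
smallest, `N`, one at `σ^N d`. The only pole of `f` on this orbit is at `d`, so `M = -1` and `N =
0`, contradicting `N ≤ M`. Hence `q` avoids the orbit and `d` divides the cleared numerator of `f`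
(`dvd_of_mul_eq_twisted_difference`), which has smaller degree in the last variable, so `a = 0`
(`eq_zero_of_isSummable`). -/

theorem zpow_apply_dvd_zpow_apply_iff (s : R ≃ₐ[K] R) (k l : ℤ) (x y : R) :
    (s ^ (k + l)) x ∣ (s ^ k) y ↔ (s ^ l) x ∣ y := by
  rw [zpow_add, AlgEquiv.mul_apply]
  exact map_dvd_iff (s ^ k)

theorem zpow_succ_apply_dvd_apply_iff (s : R ≃ₐ[K] R) (k : ℤ) (x y : R) :
    (s ^ (k + 1)) x ∣ s y ↔ (s ^ k) x ∣ y := by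
  have := zpow_apply_dvd_zpow_apply_iff s 1 k x y
  rwa [add_comm, zpow_one] at this

variable [UniqueFactorizationMonoid R]

/-- Distinct `k` give non-associated irreducibles, and `q` has finitely many irreducible factors up
to association. -/
theorem finite_setOf_zpow_apply_dvd {s : R ≃ₐ[K] R} {d : R} (hd : Irreducible d)
    (h : ∀ k : ℤ, Associated ((s ^ k) d) d → k = 0) {q : R} (hq : q ≠ 0) :
    {k : ℤ | (s ^ k) d ∣ q}.Finite := by
  classical
  have hirr (k : ℤ) : Irreducible ((s ^ k) d) := (MulEquiv.irreducible_iff (s ^ k)).2 hd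
  refine Set.Finite.of_finite_image (f := fun k => Associates.mk ((s ^ k) d)) ?_ ?_
  · refine (((UniqueFactorizationMonoid.factors q).map Associates.mk).toFinset.finite_toSet).subset
      ?_
    rintro _ ⟨k, hk, rfl⟩
    obtain ⟨r, hr, hrk⟩ :=
      UniqueFactorizationMonoid.exists_mem_factors_of_dvd hq (hirr k) hk
    simp only [Finset.mem_coe, Multiset.mem_toFinset, Multiset.mem_map]
    exact ⟨r, hr, (Associates.mk_eq_mk_iff_associated.2 hrk).symm⟩
  · intro k _ l _ hkl
    have hkl' : Associated ((s ^ k) d) ((s ^ l) d) := Associates.mk_eq_mk_iff_associated.1 hkl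
    have := hkl'.map (s ^ (-l))
    rw [← AlgEquiv.mul_apply, ← AlgEquiv.mul_apply, ← zpow_add, ← zpow_add, neg_add_cancel,
      zpow_zero, AlgEquiv.one_apply] at this
    have := h _ this
    omega

/-- If `A / (B d ^ j) = u s(p / q) - p / q` with `p / q` reduced, where the irreducible `d` is not
associated to any other element of its `s`-orbit, and no element of that orbit divides `B`, then
`d` divides `A`. -/
theorem dvd_of_mul_eq_twisted_difference [IsDomain R] {s : R ≃ₐ[K] R} {d : R} (hd : Irreducible d)
    (h : ∀ k : ℤ, Associated ((s ^ k) d) d → k = 0) {A B p q u : R} {j : ℕ} (hj : j ≠ 0)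
    (hu : IsUnit u) (hq : q ≠ 0) (hpq : IsRelPrime p q) (hB : ∀ k : ℤ, ¬ (s ^ k) d ∣ B)
    (heq : A * (s q * q) = (u * s p * q - p * s q) * (B * d ^ j)) : d ∣ A := by
  have hprime (k : ℤ) : Prime ((s ^ k) d) :=
    ((MulEquiv.irreducible_iff (s ^ k)).2 hd).prime
  have hnot (k : ℤ) (hk : (s ^ k) d ∣ q) : ¬ (s ^ k) d ∣ p :=
    fun hkp => (hprime k).not_isUnit (hpq hkp hk)
  have hBd (k : ℤ) (hk : k ≠ 0) : ¬ (s ^ k) d ∣ B * d ^ j := by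
    intro hdvd
    rcases (hprime k).dvd_or_dvd hdvd with h1 | h1
    · exact hB k h1
    · exact hk (h k ((hprime k).irreducible.associated_of_dvd hd
        ((hprime k).dvd_of_dvd_pow h1)))
  have hnum (k : ℤ) (hk : k ≠ 0) (hdvd : (s ^ k) d ∣ s q * q) :
      (s ^ k) d ∣ u * s p * q - p * s q :=
    ((hprime k).dvd_or_dvd (heq ▸ hdvd.mul_left A)).resolve_right (hBd k hk)
  -- At the upper end of a run in `q`, the next orbit element divides `s q` but not `q`, so only
  -- `s(p / q)` has a pole there.
  have hsucc (k : ℤ) (hk : (s ^ k) d ∣ q) (hk' : ¬ (s ^ (k + 1)) d ∣ q) : k + 1 = 0 := by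
    by_contra hne
    have hsq : (s ^ (k + 1)) d ∣ s q := (zpow_succ_apply_dvd_apply_iff s k d q).2 hk
    have h1 := (dvd_sub_left (hsq.mul_left p)).1 (hnum _ hne (hsq.mul_right q))
    have h2 := ((hprime _).dvd_or_dvd h1).resolve_right hk'
    exact hnot k hk ((zpow_succ_apply_dvd_apply_iff s k d p).1 (hu.dvd_mul_left.1 h2))
  -- At the lower end, the orbit element divides `q` but not `s q`, so only `p / q` has a pole.
  have hpred (k : ℤ) (hk : (s ^ k) d ∣ q) (hk' : ¬ (s ^ (k - 1)) d ∣ q) : k = 0 := by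
    by_contra hne
    have h1 := (dvd_sub_right (hk.mul_left (u * s p))).1 (hnum _ hne (hk.mul_left (s q)))
    refine hk' ((zpow_succ_apply_dvd_apply_iff s (k - 1) d q).1 ?_)
    rw [sub_add_cancel]
    exact ((hprime _).dvd_or_dvd h1).resolve_left (hnot k hk)
  have hfin := finite_setOf_zpow_apply_dvd hd h hq
  have hempty (k : ℤ) : ¬ (s ^ k) d ∣ q := by
    intro hk
    obtain ⟨M, hM, hM'⟩ := Set.exists_max_image _ id hfin ⟨k, hk⟩
    obtain ⟨N, hN, hN'⟩ := Set.exists_min_image _ id hfin ⟨k, hk⟩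
    have h1 := hsucc M hM fun hdvd => by
      have : M + 1 ≤ M := hM' (M + 1) hdvd
      omega
    have h2 := hpred N hN fun hdvd => by
      have : N ≤ N - 1 := hN' (N - 1) hdvd
      omega
    have : N ≤ M := hM' N hN
    omega
  have hdq : ¬ d ∣ q := by simpa using hempty 0
  have hdsq : ¬ d ∣ s q := by
    have := zpow_succ_apply_dvd_apply_iff s (-1) d q
    rw [neg_add_cancel, zpow_zero, AlgEquiv.one_apply] at this
    rw [this]
    exact hempty (-1)
  have hdvd : d ∣ A * (s q * q) := heq ▸ ((dvd_pow_self d hj).mul_left B).mul_left _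
  refine (hd.prime.dvd_or_dvd hdvd).resolve_right fun hc => ?_
  exact (hd.prime.dvd_or_dvd hc).elim hdsq hdq

end Dispersion

/-! ### Clearing denominators and degrees in the last variable. -/

section LastVariable

variable {m : ℕ} {F : Type*} [Field F]

theorem degreeOf_last_rename_castSucc (p : MvPolynomial (Fin m) F) :
    degreeOf (Fin.last m) (rename Fin.castSucc p) = 0 := by
  by_contra h
  have hmem : Fin.last m ∈ (rename Fin.castSucc p).vars := by
    classical
    rw [vars_def, Multiset.mem_toFinset, ← Multiset.count_pos, ← degreeOf_def]
    exact Nat.pos_of_ne_zero h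
  obtain ⟨i, -, hi⟩ := mem_vars_rename _ _ hmem
  exact Fin.castSucc_ne_last i hi

/-- The inclusion of `F[α₁, …, αₘ][αₘ₊₁]` in `F[α₁, …, αₘ₊₁]`. -/
noncomputable def ofLastPolynomial (m : ℕ) (F : Type*) [Field F] :
    Polynomial (MvPolynomial (Fin m) F) →+* MvPolynomial (Fin (m + 1)) F :=
  Polynomial.eval₂RingHom (rename Fin.castSucc : MvPolynomial (Fin m) F →ₐ[F] _).toRingHom
    (X (Fin.last m))

theorem ofLastPolynomial_injective : Function.Injective (ofLastPolynomial m F) := by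
  let r : MvPolynomial (Fin (m + 1)) F →+* Polynomial (MvPolynomial (Fin m) F) :=
    eval₂Hom (Polynomial.C.comp C)
      (Fin.lastCases Polynomial.X fun i => Polynomial.C (X i))
  have hr : r.comp (ofLastPolynomial m F) = RingHom.id _ := by
    refine Polynomial.ringHom_ext' (MvPolynomial.ringHom_ext ?_ ?_) ?_ <;>
      simp [r, ofLastPolynomial]
  exact Function.LeftInverse.injective (g := r) fun p => RingHom.congr_fun hr p

theorem degreeOf_last_ofLastPolynomial_le (N : Polynomial (MvPolynomial (Fin m) F)) :
    degreeOf (Fin.last m) (ofLastPolynomial m F N) ≤ N.natDegree := by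
  classical
  simp only [ofLastPolynomial, Polynomial.coe_eval₂RingHom]
  rw [Polynomial.eval₂_eq_sum, Polynomial.sum]
  refine (degreeOf_sum_le _ _ _).trans (Finset.sup_le fun i hi => ?_)
  refine (degreeOf_mul_le _ _ _).trans ?_
  have h1 : degreeOf (Fin.last m) ((rename Fin.castSucc : MvPolynomial (Fin m) F →ₐ[F]
      MvPolynomial (Fin (m + 1)) F).toRingHom (N.coeff i)) = 0 :=
    degreeOf_last_rename_castSucc _
  have h2 := degreeOf_pow_le (Fin.last m) (X (Fin.last m) : MvPolynomial (Fin (m + 1)) F) i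
  rw [degreeOf_X, if_pos rfl, mul_one] at h2
  rw [h1, zero_add]
  exact h2.trans (Polynomial.le_natDegree_of_mem_supp i hi)

theorem inclPoly_map_algebraMap (N : Polynomial (MvPolynomial (Fin m) F)) :
    inclPoly m F (N.map (algebraMap _ (RatField m F))) =
      algebraMap _ (RatField (m + 1) F) (ofLastPolynomial m F N) := by
  have : (inclPoly m F).comp (Polynomial.mapRingHom (algebraMap _ (RatField m F))) =
      (algebraMap _ (RatField (m + 1) F)).comp (ofLastPolynomial m F) := by
    refine Polynomial.ringHom_ext (fun p => ?_) ?_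
    · simp [inclPoly, ofLastPolynomial, inclField_algebraMap]
    · simp [inclPoly, ofLastPolynomial]
  exact RingHom.congr_fun this N

/-- A nonzero polynomial in `αₘ₊₁` over `F(α₁, …, αₘ)` becomes, after clearing denominators, a
nonzero polynomial in `F[α₁, …, αₘ₊₁]` of at most the same degree in `αₘ₊₁`. -/
theorem exists_mul_inclPoly_eq {a : Polynomial (RatField m F)} (ha : a ≠ 0) :
    ∃ (A : MvPolynomial (Fin (m + 1)) F) (b : MvPolynomial (Fin m) F), A ≠ 0 ∧ b ≠ 0 ∧
      degreeOf (Fin.last m) A ≤ a.natDegree ∧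
      algebraMap _ (RatField (m + 1) F) (rename Fin.castSucc b) * inclPoly m F a =
        algebraMap _ (RatField (m + 1) F) A := by
  set N := IsLocalization.integerNormalization (nonZeroDivisors (MvPolynomial (Fin m) F)) a
    with hN
  obtain ⟨b, hb, hbN⟩ := IsLocalization.integerNormalization_spec
    (nonZeroDivisors (MvPolynomial (Fin m) F)) a
  rw [← hN] at hbN
  have hN0 : N ≠ 0 := fun h => ha (IsFractionRing.integerNormalization_eq_zero_iff.1 h)
  have hdeg : N.natDegree ≤ a.natDegree := by
    -- Normalization only rescales coefficients, so the support does not grow.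
    refine Polynomial.natDegree_le_natDegree (Finset.sup_mono ?_)
    exact IsLocalization.integerNormalization_support _ a
  refine ⟨ofLastPolynomial m F N, b, ?_, nonZeroDivisors.ne_zero hb,
    (degreeOf_last_ofLastPolynomial_le N).trans hdeg, ?_⟩
  · rwa [Ne, map_eq_zero_iff _ ofLastPolynomial_injective]
  · rw [← inclPoly_map_algebraMap, hbN, ← algebraMap_smul (RatField m F) b a,
      Polynomial.smul_eq_C_mul, map_mul]
    congr 1
    simp [inclPoly, inclField_algebraMap]

theorem sigmaPoly_rename_castSucc (lam : Fin (m + 1) → Fˣ) (p : MvPolynomial (Fin m) F) :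
    sigmaPoly lam (rename Fin.castSucc p) =
      rename Fin.castSucc (sigmaPoly (fun i => lam i.castSucc) p) := by
  have : (sigmaPoly lam).toAlgHom.comp (rename Fin.castSucc) =
      (rename Fin.castSucc).comp (sigmaPoly fun i => lam i.castSucc).toAlgHom := by
    ext1 i
    simp [sigmaPoly_X]
  exact DFunLike.congr_fun this p

theorem zpow_sigmaPoly_rename_castSucc (lam : Fin (m + 1) → Fˣ) (k : ℤ)
    (p : MvPolynomial (Fin m) F) :
    (sigmaPoly lam ^ k) (rename Fin.castSucc p) =
      rename Fin.castSucc ((sigmaPoly (fun i => lam i.castSucc) ^ k) p) := by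
  induction k generalizing p with
  | zero => simp
  | succ k ih => simp only [zpow_add_one, AlgEquiv.mul_apply, sigmaPoly_rename_castSucc, ih]
  | pred k ih =>
    -- Writing the argument as an image under `σ` turns the exponent `-k - 1` into `-k`.
    obtain ⟨p, rfl⟩ := (sigmaPoly fun i => lam i.castSucc).surjective p
    rw [← sigmaPoly_rename_castSucc, ← AlgEquiv.mul_apply, ← AlgEquiv.mul_apply,
      ← zpow_add_one, ← zpow_add_one, sub_add_cancel]
    exact ih p

theorem degreeOf_le_of_dvd {σ R : Type*} [CommRing R] [IsDomain R] {p q : MvPolynomial σ R}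
    (i : σ) (h : p ∣ q) (hq : q ≠ 0) : degreeOf i p ≤ degreeOf i q := by
  obtain ⟨r, rfl⟩ := h
  rw [degreeOf_mul_eq (left_ne_zero_of_mul hq) (right_ne_zero_of_mul hq)]
  exact Nat.le_add_right _ _

/-- Applying `σ^(-k)` keeps `b` free of the last variable, whereas `d` involves it. -/
theorem not_zpow_sigmaPoly_dvd_rename_castSucc (lam : Fin (m + 1) → Fˣ)
    {d : MvPolynomial (Fin (m + 1)) F} (hd : 0 < degreeOf (Fin.last m) d)
    {b : MvPolynomial (Fin m) F} (hb : b ≠ 0) (k : ℤ) :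
    ¬ (sigmaPoly lam ^ k) d ∣ rename Fin.castSucc b := by
  intro hdvd
  have h := (map_dvd_iff (sigmaPoly lam ^ (-k))).2 hdvd
  rw [← AlgEquiv.mul_apply, ← zpow_add, neg_add_cancel, zpow_zero, AlgEquiv.one_apply,
    zpow_sigmaPoly_rename_castSucc] at h
  refine hd.not_ge ((degreeOf_le_of_dvd (Fin.last m) h ?_).trans
    (degreeOf_last_rename_castSucc _).le)
  rw [Ne, map_eq_zero_iff _ (rename_castSucc_injective m F), EmbeddingLike.map_eq_zero_iff]
  exact hb

end LastVariable

theorem mem_spread_of_associated {n : ℕ} {F : Type*} [Field F] {lam : Fin n → Fˣ}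
    {p q : MvPolynomial (Fin n) F} {k : ℤ} (h : Associated ((sigmaPoly lam ^ k) p) q) :
    k ∈ spread lam p q := by
  obtain ⟨u, hu⟩ := h.symm
  obtain ⟨r, hr, hur⟩ := isUnit_iff_eq_C_of_isReduced.1 u.isUnit
  exact ⟨r, hr.ne_zero, by rw [← hu, hur, mul_comm]⟩

/-- The numerator of a summable fraction over a power of `d` is zero if `d` is irreducible of
trivial spread and has larger degree in the last variable. -/
theorem eq_zero_of_isSummable {m : ℕ} {F : Type*} [Field F] {lam : Fin (m + 1) → Fˣ} {c : F}
    (hc : c ≠ 0) {d : MvPolynomial (Fin (m + 1)) F} (hd : Irreducible d)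
    (hspr : spread lam d d = {0}) {j : ℕ} (hj : j ≠ 0) {a : Polynomial (RatField m F)}
    (ha : a.degree < (degreeOf (Fin.last m) d : WithBot ℕ))
    (hf : IsSummable lam c
      (inclPoly m F a / algebraMap _ (RatField (m + 1) F) d ^ j)) : a = 0 := by
  by_contra ha0
  obtain ⟨A, b, hA, hb, hdeg, hbA⟩ := exists_mul_inclPoly_eq ha0
  have hlt : a.natDegree < degreeOf (Fin.last m) d := by
    rwa [Polynomial.degree_eq_natDegree ha0, Nat.cast_lt] at ha
  obtain ⟨g, hg⟩ := hf
  obtain ⟨p, q, hpq, rfl⟩ :=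
    IsFractionRing.exists_reduced_fraction (MvPolynomial (Fin (m + 1)) F) g
  obtain ⟨q, hq⟩ := q
  have hq0 : q ≠ 0 := nonZeroDivisors.ne_zero hq
  have hinj := IsFractionRing.injective (MvPolynomial (Fin (m + 1)) F) (RatField (m + 1) F)
  have hne {x : MvPolynomial (Fin (m + 1)) F} (hx : x ≠ 0) :
      algebraMap _ (RatField (m + 1) F) x ≠ 0 := by
    rwa [Ne, map_eq_zero_iff _ hinj]
  have hdvd : d ∣ A := by
    refine dvd_of_mul_eq_twisted_difference (s := sigmaPoly lam) hd (fun k hk => ?_) hj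
      (u := C c) (hc.isUnit.map C) hq0 hpq
      -- Since `a ≠ 0`, the degree bound forces `d` to involve the last variable.
      (not_zpow_sigmaPoly_dvd_rename_castSucc lam (Nat.zero_lt_of_lt hlt) hb) (hinj ?_)
    · simpa [hspr] using mem_spread_of_associated hk
    · have hd' := hne hd.ne_zero
      have hq' := hne hq0
      have hsq' : algebraMap _ (RatField (m + 1) F) (sigmaPoly lam q) ≠ 0 :=
        hne ((EmbeddingLike.map_ne_zero_iff).2 hq0)
      rw [IsFractionRing.mk'_eq_div, map_div₀, sigma_algebraMap, sigma_algebraMap,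
        IsScalarTower.algebraMap_apply F (MvPolynomial (Fin (m + 1)) F),
        algebraMap_eq] at hg
      simp only [map_mul, map_sub, map_pow]
      rw [← hbA]
      field_simp at hg
      linear_combination (algebraMap _ (RatField (m + 1) F) (rename Fin.castSucc b)) * hg
  exact ((degreeOf_le_of_dvd (Fin.last m) hdvd hA).trans hdeg).not_gt hlt

end MultivariateDifferenceField

theorem mainTheorem2 (F : Subfield (AlgebraicClosure ℚ)) (m : ℕ)
    (lam : Fin (m + 1) → (↥F)ˣ) (c : ↥F) (hc : c ≠ 0)
    (d : MvPolynomial (Fin (m + 1)) ↥F) (hd : Irreducible d)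
    (hdα : ¬ MultivariateDifferenceField.SigmaEquivalent lam d
      (MvPolynomial.X (Fin.last m)))
    (j : ℕ) (hj : j ≠ 0)
    (a : Polynomial (MultivariateDifferenceField.RatField m ↥F))
    (ha : a.degree < (MvPolynomial.degreeOf (Fin.last m) d : WithBot ℕ))
    (hspr : MultivariateDifferenceField.spread lam d d = {0}) :
    MultivariateDifferenceField.IsSummable lam c
      (MultivariateDifferenceField.inclPoly m ↥F a /
        algebraMap (MvPolynomial (Fin (m + 1)) ↥F)
          (MultivariateDifferenceField.RatField (m + 1) ↥F) d ^ j) ↔ a = 0 := by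
  constructor
  · exact MultivariateDifferenceField.eq_zero_of_isSummable hc hd hspr hj ha
  · rintro rfl
    exact ⟨0, by simp⟩
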